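/- Let $E$ be a finite or infinite dimensional real Hilbert space, let $L(E;E)$ be the Banach space of continuous linear maps $E\to E$ (products below are compositions), and let $G(E)\subset L(E;E)$ be the Grassmann manifold, i.e. the set of orthogonal projections of $E$ onto its closed vector subspaces, with tangent spaces $T_\xi(G(E))\subset L(E;E)$. A connection in the tangent bundle of a manifold $M\subset B$ ($B$ a Banach space) is identified with its second fundamental forms, bilinear maps $\theta_x:T_x(M)\times T_x(M)\to B$ with $(u,\theta_x(w,u))\in T_{(x,w)}(TM)$; the covariant derivative is $\nabla W_x(u)=DW_x(u)-\theta_x(W_x,u)$. If $\hat\theta$ is a smooth map from $M$ into the space of continuous bilinear maps $B\times B\to B$ such that every $\theta_x$ is a restriction of $\hat\theta_x$, the curvature tensor $R_x:T_x(M)\times T_x(M)\times T_x(M)\to T_x(M)$ is $$R_x(u,v,w)=D\hat\theta_x(u)(w,v)-D\hat\theta_x(v)(w,u)+\hat\theta_x(\theta_x(w,u),v)-\hat\theta_x(\theta_x(w,v),u).$$ For $\xi\in G(E)$ let $T_\xi(G(E))^\perp$ be the set of self-adjoint $\eta\in L(E;E)$ with $\eta\xi=\xi\eta$. The canonical connection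 of $G(E)$ is the connection $\theta$ with $\theta_\xi(\eta,\alpha)\in T_\xi(G(E))^\perp$ for all $\xi\in G(E)$ and $\eta,\alpha\in T_\xi(G(E))$. Then: 1. There is exactly one canonical connection, and it is given by $$\theta_\xi(\eta,\alpha)=(\mathrm{Id}-2\xi)\eta\alpha+\alpha\eta(\mathrm{Id}-2\xi)\qquad(\xi\in G(E),\ \eta,\alpha\in T_\xi(G(E))).$$ 2. It has a smooth extension $\hat\theta$, its curvature tensor $R$ does not depend on the choice of the smooth extension, and for all $\xi\in G(E)$ and $\alpha,\beta,\eta\in T_\xi(G(E))$ $$R_\xi(\alpha,\beta,\eta)=\eta\alpha\beta-\eta\beta\alpha+\beta\alpha\eta-\alpha\beta\eta.$$ 3. Suppose that $E$ has finite dimension $N$, and let $\langle\xi,\eta\rangle=\sum_k\langle\xi(x_k),\eta(x_k)\rangle$, for an orthonormal basis $(x_k)$ of $E$, be the Hilbert-Schmidt inner product in $L(E;E)$, with norm $|\cdot|$. Then for all $\xi\in G(E)$ and $\alpha,\beta\in T_\xi(G(E))$ the sectional term $\mathrm{Riem}_\xi(\alpha,\beta):=\langle R_\xi(\alpha,\beta,\alpha),\beta\rangle$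 satisfies $$\mathrm{Riem}_\xi(\alpha,\beta)=2|\alpha\beta|^2-2\langle\alpha\beta,\beta\alpha\rangle\ge 0,$$ with $\mathrm{Riem}_\xi(\alpha,\beta)=0$ if and only if $\alpha\beta=\beta\alpha$; and the Ricci curvature, defined by letting $\mathrm{Ricci}_\xi(\alpha,\beta)$ be the trace of the endomorphism $\gamma\mapsto R_\xi(\alpha,\gamma,\beta)$ of $T_\xi(G(E))$, is $$\mathrm{Ricci}_\xi(\alpha,\beta)=\frac{N-2}{2}\langle\alpha,\beta\rangle.$$ -/

import Mathlib

open scoped ContDiff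

noncomputable section

namespace GrassmannCurvature

section Manifolds

variable {B : Type*} [NormedAddCommGroup B] [NormedSpace ℝ B]

/-- The tangent vector space at `x` of a subset `M` of a normed space `B`, a vector subspace of
the ambient space: the linear span of the tangent cone. For an embedded submanifold it is the
usual tangent space. -/
def tangentAt (M : Set B) (x : B) : Submodule ℝ B :=
  Submodule.span ℝ (tangentConeAt ℝ M x)

/-- The tangent bundle `{(x, w) | x ∈ M, w ∈ T_x(M)}`, as a subset of `B × B`. -/
def tangentBundleSet (M : Set B) : Set (B × B) :=
  {p | p.1 ∈ M ∧ p.2 ∈ tangentAt M p.1}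

/-- Families of bilinear maps `θ_x : T_x(M) × T_x(M) → B`, `(w, u) ↦ θ_x(w, u)`. -/
abbrev BilinearFamily (M : Set B) :=
  ∀ x : M, tangentAt M (x : B) →ₗ[ℝ] tangentAt M (x : B) →ₗ[ℝ] B

/-- Families of trilinear maps `R_x : T_x(M) × T_x(M) × T_x(M) → T_x(M)`. -/
abbrev TrilinearFamily (M : Set B) :=
  ∀ x : M, tangentAt M (x : B) →ₗ[ℝ] tangentAt M (x : B) →ₗ[ℝ]
    tangentAt M (x : B) →ₗ[ℝ] tangentAt M (x : B)

/-- A connection in the tangent bundle of `M`, identified with its second fundamental forms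
`θ_x`: the covariant derivative of a vector field `W` in the direction `u` is
`DW_x(u) - θ_x(W_x, u)`, and the condition on `θ` is `(u, θ_x(w, u)) ∈ T_{(x, w)}(TM)`. -/
def IsConnection {M : Set B} (θ : BilinearFamily M) : Prop :=
  ∀ (x : M) (w u : tangentAt M (x : B)),
    ((u : B), θ x w u) ∈ tangentAt (tangentBundleSet M) ((x : B), (w : B))

/-- `Θ` is a smooth map from `M` to the space of continuous bilinear maps `B × B → B` such that
every `θ_x` is a restriction of `Θ_x`. -/
def IsSmoothExtension {M : Set B} (θ : BilinearFamily M) (Θ : B → B →L[ℝ] B →L[ℝ] B) : Prop :=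
  ContDiffOn ℝ ∞ Θ M ∧
    ∀ (x : M) (w u : tangentAt M (x : B)), Θ x w u = θ x w u

/-- The curvature expression
`DΘ_x(u)(w, v) - DΘ_x(v)(w, u) + Θ_x(Θ_x(w, u), v) - Θ_x(Θ_x(w, v), u)`.
It is used for `u`, `v` tangent to `M` at `x` only, where the derivative along `M` does not depend
on the choice made by `fderivWithin`. -/
def curvatureExpr (M : Set B) (Θ : B → B →L[ℝ] B →L[ℝ] B) (x u v w : B) : B :=
  fderivWithin ℝ Θ M x u w v - fderivWithin ℝ Θ M x v w u
    + Θ x (Θ x w u) v - Θ x (Θ x w v) u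

/-- `R` is the curvature tensor of the connection `θ`: `θ` has a smooth extension, and `R` is given
by the curvature expression of every smooth extension of `θ`. The sign is the one for which
`R(u, v, w) = ∇_v ∇_u w - ∇_u ∇_v w + ∇_[u, v] w`. -/
def IsCurvatureTensor {M : Set B} (θ : BilinearFamily M) (R : TrilinearFamily M) : Prop :=
  (∃ Θ, IsSmoothExtension θ Θ) ∧
    ∀ Θ, IsSmoothExtension θ Θ → ∀ (x : M) (u v w : tangentAt M (x : B)),
      (R x u v w : B) = curvatureExpr M Θ x u v w

/-- `Ricci_x(u, w)` is the trace of the endomorphism `v ↦ R_x(u, v, w)` of `T_x(M)`. -/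
def ricci {M : Set B} (R : TrilinearFamily M) (x : M) (u w : tangentAt M (x : B)) : ℝ :=
  LinearMap.trace ℝ (tangentAt M (x : B)) ((R x u).flip w)

end Manifolds

section Grassmann

variable (E : Type*) [NormedAddCommGroup E] [InnerProductSpace ℝ E] [CompleteSpace E]

/-- The Grassmann manifold `G(E)`: the set of all orthogonal projections of `E` onto closed
vector subspaces. -/
def grassmann : Set (E →L[ℝ] E) :=
  {ξ | ∃ F : Submodule ℝ E, IsClosed (F : Set E) ∧
    ∃ _ : F.HasOrthogonalProjection, ξ = F.starProjection}

variable {E}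

/-- The complement `T_ξ(G(E))^⊥` of `T_ξ(G(E))` in the space of self-adjoint maps: the
self-adjoint maps that commute with `ξ`. -/
def normalAt (ξ : E →L[ℝ] E) : Set (E →L[ℝ] E) :=
  {η | IsSelfAdjoint η ∧ η * ξ = ξ * η}

/-- The canonical connection of `G(E)`: the connection such that all `θ_ξ(η, α)` are in
`T_ξ(G(E))^⊥`. -/
def IsCanonicalConnection (θ : BilinearFamily (grassmann E)) : Prop :=
  IsConnection θ ∧
    ∀ (ξ : grassmann E) (η α : tangentAt (grassmann E) (ξ : E →L[ℝ] E)),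
      θ ξ η α ∈ normalAt (ξ : E →L[ℝ] E)

end Grassmann

section FiniteDimension

variable {E : Type*} [NormedAddCommGroup E] [InnerProductSpace ℝ E] [FiniteDimensional ℝ E]

/-- The Hilbert-Schmidt inner product `∑ k, ⟨ξ(x_k), η(x_k)⟩`, for an orthonormal basis `x`. -/
def hsInner (ξ η : E →L[ℝ] E) : ℝ :=
  ∑ k, inner ℝ (ξ (stdOrthonormalBasis ℝ E k)) (η (stdOrthonormalBasis ℝ E k))

/-- The Hilbert-Schmidt inner product does not depend on the orthonormal basis. -/
theorem hsInner_eq_sum {ι : Type*} [Fintype ι] (x : OrthonormalBasis ι ℝ E) (ξ η : E →L[ℝ] E) :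
    hsInner ξ η = ∑ k, inner ℝ (ξ (x k)) (η (x k)) := by
  have key : ∀ {κ : Type _} [Fintype κ] (y : OrthonormalBasis κ ℝ E),
      ∑ k, inner ℝ (ξ (y k)) (η (y k)) =
        LinearMap.trace ℝ E (LinearMap.adjoint (ξ : E →ₗ[ℝ] E) ∘ₗ (η : E →ₗ[ℝ] E)) := by
    intro κ _ y
    rw [LinearMap.trace_eq_sum_inner _ y]
    refine Finset.sum_congr rfl fun k _ => ?_
    rw [LinearMap.comp_apply, LinearMap.adjoint_inner_right]
    rfl
  have key2 : ∑ k, inner ℝ (ξ (x k)) (η (x k)) =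
        LinearMap.trace ℝ E (LinearMap.adjoint (ξ : E →ₗ[ℝ] E) ∘ₗ (η : E →ₗ[ℝ] E)) := by
    rw [LinearMap.trace_eq_sum_inner _ x]
    refine Finset.sum_congr rfl fun k _ => ?_
    rw [LinearMap.comp_apply, LinearMap.adjoint_inner_right]
    rfl
  rw [key2]
  exact key _

/-- The sectional term `Riem_ξ(α, β) = ⟨R_ξ(α, β, α), β⟩`. -/
def riem {M : Set (E →L[ℝ] E)} (R : TrilinearFamily M) (ξ : M)
    (α β : tangentAt M (ξ : E →L[ℝ] E)) : ℝ :=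
  hsInner (R ξ α β α : E →L[ℝ] E) (β : E →L[ℝ] E)

end FiniteDimension

end GrassmannCurvature

end

/-! `G(E)` is the set of self-adjoint idempotents `p` of `L(E;E)`. With the reflection `s = 1 - 2p`,
tangent vectors at `p` are the self-adjoint `u` that anticommute with `s`. For such `u`, `a = su` is
skew and `[a, p] = u`, so conjugation by `exp(ta)` moves `p` inside `G(E)` with velocity `u`, and
carries along tangent vectors and every expression built algebraically from `p`.

Existence: the transported `w` has derivative `[a, w] = canonicalForm p w u`, so this vector
satisfies the tangency condition. Uniqueness: differentiating `pw + wp = w` determines any second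
component `z` that commutes with `p` (`eq_canonicalForm_of_mem_tangentAt`).

Curvature: differentiating the transported form gives `DΘ(u)(w,v) + Θ(Θ(w,u),v) + Θ(w,Θ(v,u)) = [a,
θ(w,v)]` for every extension `Θ`. The last term on the left is symmetric in `u, v`, so
antisymmetrizing leaves exactly the curvature expression; the right side is an explicit cubic
polynomial (`generator_bracket_canonicalForm`).

In finite dimension, cyclicity of the trace turns `Riem` into `|αβ - βα|²`. The Ricci trace is
extended to all of `L(E;E)` through the projection onto the tangent space and computed from the
traces of `x ↦ axb` and `x ↦ ax*b`. -/

noncomputable section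

namespace GrassmannCurvature

/-! ### Algebra of projections, reflections and conjugation by one-parameter groups. -/

section StarAlgebra

variable {A : Type*} [NormedRing A] [NormedAlgebra ℝ A]

/-- The reflection `1 - 2p` attached to a projection `p`. -/
def reflectionOf (p : A) : A := 1 - (2 : ℝ) • p

theorem reflectionOf_mul_self {p : A} (hp : IsIdempotentElem p) :
    reflectionOf p * reflectionOf p = 1 := by
  have h : p * p = p := hp
  simp only [reflectionOf, mul_sub, sub_mul, mul_one, one_mul, smul_mul_assoc, mul_smul_comm, h]
  module

theorem reflectionOf_mul_eq_neg_iff {p u : A} :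
    reflectionOf p * u = -(u * reflectionOf p) ↔ p * u + u * p = u := by
  have h : reflectionOf p * u + u * reflectionOf p = (2 : ℝ) • (u - (p * u + u * p)) := by
    simp only [reflectionOf, mul_sub, sub_mul, mul_one, one_mul, smul_mul_assoc, mul_smul_comm]
    module
  rw [eq_neg_iff_add_eq_zero, h, smul_eq_zero, sub_eq_zero]
  simp [eq_comm]

theorem reflectionOf_commute_iff {p u : A} :
    reflectionOf p * u = u * reflectionOf p ↔ u * p = p * u := by
  have h : reflectionOf p * u - u * reflectionOf p = (2 : ℝ) • (u * p - p * u) := by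
    simp only [reflectionOf, mul_sub, sub_mul, mul_one, one_mul, smul_mul_assoc, mul_smul_comm]
    module
  rw [← sub_eq_zero, h, smul_eq_zero, sub_eq_zero]
  simp

/-- Conjugation of `x` by the one-parameter group generated by `a`. -/
def conjExp (a : A) (t : ℝ) (x : A) : A :=
  NormedSpace.exp (t • a) * x * NormedSpace.exp (t • (-a))

variable [CompleteSpace A]

theorem exp_smul_neg_mul (a : A) (t : ℝ) :
    NormedSpace.exp (t • (-a)) * NormedSpace.exp (t • a) = 1 := by
  let _ : NormedAlgebra ℚ A := NormedAlgebra.restrictScalars ℚ ℝ A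
  rw [smul_neg, ← NormedSpace.exp_add_of_commute (Commute.refl (t • a)).neg_left, neg_add_cancel,
    NormedSpace.exp_zero]

theorem conjExp_mul (a : A) (t : ℝ) (x y : A) :
    conjExp a t (x * y) = conjExp a t x * conjExp a t y := by
  have h := exp_smul_neg_mul a t
  simp only [conjExp]
  rw [mul_assoc _ y, show NormedSpace.exp (t • a) * x * NormedSpace.exp (t • -a) *
    (NormedSpace.exp (t • a) * (y * NormedSpace.exp (t • -a))) = NormedSpace.exp (t • a) * x *
    (NormedSpace.exp (t • -a) * NormedSpace.exp (t • a)) * (y * NormedSpace.exp (t • -a)) by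
      simp only [mul_assoc], h]
  simp only [mul_assoc, mul_one]

omit [CompleteSpace A] in
theorem conjExp_add (a : A) (t : ℝ) (x y : A) :
    conjExp a t (x + y) = conjExp a t x + conjExp a t y := by
  simp only [conjExp, mul_add, add_mul]

theorem conjExp_reflectionOf (a : A) (t : ℝ) (p : A) :
    conjExp a t (reflectionOf p) = reflectionOf (conjExp a t p) := by
  have h := exp_smul_neg_mul (-a) t
  rw [neg_neg] at h
  simp only [conjExp, reflectionOf, mul_sub, sub_mul, mul_one, smul_mul_assoc, mul_smul_comm, h]

omit [CompleteSpace A] in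
theorem conjExp_zero (a x : A) : conjExp a 0 x = x := by
  simp [conjExp]

theorem hasDerivAt_conjExp (a x : A) :
    HasDerivAt (fun t => conjExp a t x) (a * x - x * a) 0 := by
  have h1 := hasDerivAt_exp_smul_const (𝕂 := ℝ) a 0
  have h2 := hasDerivAt_exp_smul_const (𝕂 := ℝ) (-a) 0
  refine ((h1.mul_const x).mul h2).congr_deriv ?_
  simp [sub_eq_add_neg]

variable [StarRing A] [ContinuousStar A] [StarModule ℝ A]

omit [CompleteSpace A] in
theorem star_conjExp {a : A} (ha : star a = -a) (t : ℝ) (x : A) :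
    star (conjExp a t x) = conjExp a t (star x) := by
  simp only [conjExp, star_mul, NormedSpace.star_exp, star_smul, star_neg, ha, neg_neg, mul_assoc,
    star_trivial]

theorem conjExp_isStarProjection {a p : A} (ha : star a = -a) (hp : IsStarProjection p) (t : ℝ) :
    IsStarProjection (conjExp a t p) := by
  refine ⟨?_, ?_⟩
  · rw [IsIdempotentElem, ← conjExp_mul, hp.isIdempotentElem.eq]
  · rw [IsSelfAdjoint, star_conjExp ha, hp.isSelfAdjoint.star_eq]

/-- The self-adjoint elements which anticommute with the reflection `1 - 2p`. -/
def IsTangent (p u : A) : Prop :=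
  star u = u ∧ reflectionOf p * u = -(u * reflectionOf p)

theorem conjExp_isTangent {a p u : A} (ha : star a = -a) (hu : IsTangent p u) (t : ℝ) :
    IsTangent (conjExp a t p) (conjExp a t u) := by
  refine ⟨by rw [star_conjExp ha, hu.1], ?_⟩
  rw [← conjExp_reflectionOf, ← conjExp_mul, ← conjExp_mul, hu.2]
  simp [conjExp]

omit [CompleteSpace A] [ContinuousStar A] in
theorem star_reflectionOf {p : A} (hp : IsStarProjection p) :
    star (reflectionOf p) = reflectionOf p := by
  simp [reflectionOf, hp.isSelfAdjoint.star_eq]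

/-- The generator `(1 - 2p)u` of the curve through the projection `p` with velocity `u`. -/
def generator (p u : A) : A := reflectionOf p * u

omit [CompleteSpace A] [ContinuousStar A] in
-- The factors `1 - 2p` and `u` are self-adjoint and anticommute. Skewness makes conjugation by
-- `exp(ta)` commute with the star, hence preserve projections and tangency.
theorem star_generator {p u : A} (hp : IsStarProjection p) (hu : IsTangent p u) :
    star (generator p u) = -generator p u := by
  rw [generator, star_mul, hu.1, star_reflectionOf hp, hu.2, neg_neg]

omit [CompleteSpace A] [ContinuousStar A] [StarModule ℝ A] in
theorem generator_bracket_self {p u : A} (hp : IsStarProjection p) (hu : IsTangent p u) :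
    generator p u * p - p * generator p u = u := by
  have h1 : p * p = p := hp.isIdempotentElem
  have h2 := reflectionOf_mul_eq_neg_iff.1 hu.2
  -- Multiplying `pu + up = u` by `p` on the left gives `pu + pup = pu`.
  have h3 : p * u * p = 0 := by
    have := congrArg (p * ·) h2
    simpa [mul_add, ← mul_assoc, h1] using this
  simp only [generator, reflectionOf, mul_sub, sub_mul, one_mul, smul_mul_assoc,
    mul_smul_comm, h3, ← mul_assoc, h1]
  rw [smul_zero, sub_zero]
  nth_rw 4 [← h2]
  module

/-- The second fundamental form `(1 - 2p)(wu) + (uw)(1 - 2p)`. -/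
def canonicalForm (p w u : A) : A := reflectionOf p * w * u + u * w * reflectionOf p

omit [StarRing A] [ContinuousStar A] [StarModule ℝ A] in
-- Conjugation is multiplicative and fixes `1`, so it respects any formula built from `p`, `w`, `u`.
theorem conjExp_canonicalForm (a p w u : A) (t : ℝ) :
    conjExp a t (canonicalForm p w u) =
      canonicalForm (conjExp a t p) (conjExp a t w) (conjExp a t u) := by
  simp only [canonicalForm, conjExp_add, conjExp_mul, conjExp_reflectionOf]

omit [CompleteSpace A] [ContinuousStar A] [StarModule ℝ A] in
theorem IsTangent.mul_commute {p u w : A} (hu : IsTangent p u) (hw : IsTangent p w) :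
    reflectionOf p * (u * w) = u * w * reflectionOf p := by
  rw [← mul_assoc, hu.2, neg_mul, mul_assoc, hw.2, mul_neg, neg_neg, mul_assoc]

omit [CompleteSpace A] [ContinuousStar A] [StarModule ℝ A] in
theorem canonicalForm_eq {p u w : A} (hu : IsTangent p u) (hw : IsTangent p w) :
    canonicalForm p w u = reflectionOf p * (w * u + u * w) := by
  rw [canonicalForm, ← hu.mul_commute hw, mul_add, mul_assoc]

omit [CompleteSpace A] [ContinuousStar A] [StarModule ℝ A] in
theorem canonicalForm_comm {p u w : A} (hu : IsTangent p u) (hw : IsTangent p w) :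
    canonicalForm p w u = canonicalForm p u w := by
  rw [canonicalForm_eq hu hw, canonicalForm_eq hw hu, add_comm]

omit [CompleteSpace A] [ContinuousStar A] [StarModule ℝ A] in
theorem generator_bracket {p u w : A} (hu : IsTangent p u) :
    generator p u * w - w * generator p u = canonicalForm p u w := by
  rw [generator, hu.2, canonicalForm, hu.2]
  noncomm_ring

omit [CompleteSpace A] [ContinuousStar A] [StarModule ℝ A] in
-- Both factors carry one reflection `s`, and `s` commutes with `wv + vw`; the two copies meet as
-- `s² = 1`, which is why `p` disappears from the result and from the curvature.
theorem generator_bracket_canonicalForm {p u v w : A} (hp : IsStarProjection p)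
    (hu : IsTangent p u) (hv : IsTangent p v) (hw : IsTangent p w) :
    generator p u * canonicalForm p w v - canonicalForm p w v * generator p u =
      -(u * (w * v + v * w) + (w * v + v * w) * u) := by
  have hs := reflectionOf_mul_self hp.isIdempotentElem
  have hc : reflectionOf p * (w * v + v * w) = (w * v + v * w) * reflectionOf p := by
    rw [mul_add, add_mul, hw.mul_commute hv, hv.mul_commute hw]
  rw [canonicalForm_eq hv hw, generator, hu.2]
  have h1 : -(u * reflectionOf p) * (reflectionOf p * (w * v + v * w)) =
      -(u * (reflectionOf p * reflectionOf p) * (w * v + v * w)) := by noncomm_ring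
  have h2 : reflectionOf p * (w * v + v * w) * -(u * reflectionOf p) =
      (w * v + v * w) * u := by
    rw [← hu.2, hc, mul_assoc, ← mul_assoc (reflectionOf p), hs, one_mul]
  rw [h1, h2, hs, mul_one]
  abel

omit [CompleteSpace A] [ContinuousStar A] in
theorem star_canonicalForm {p u w : A} (hp : IsStarProjection p)
    (hu : IsTangent p u) (hw : IsTangent p w) :
    star (canonicalForm p w u) = canonicalForm p w u := by
  simp only [canonicalForm, star_add, star_mul, hu.1, hw.1, star_reflectionOf hp]
  rw [add_comm]
  simp only [mul_assoc]

omit [CompleteSpace A] [ContinuousStar A] [StarModule ℝ A] in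
theorem reflectionOf_mul_canonicalForm {p u w : A} (hu : IsTangent p u) (hw : IsTangent p w) :
    reflectionOf p * canonicalForm p w u = canonicalForm p w u * reflectionOf p := by
  rw [canonicalForm_eq hu hw, mul_assoc, mul_add, add_mul, hw.mul_commute hu, hu.mul_commute hw]

/-- The trilinear expression `wuv - wvu + vuw - uvw`. -/
def curvatureForm (u v w : A) : A := w * u * v - w * v * u + v * u * w - u * v * w

omit [CompleteSpace A] [ContinuousStar A] [StarModule ℝ A] in
-- Moving `s` past three anticommuting factors costs one sign, and the star exchanges `wuv` with
-- `vuw` and `wvu` with `uvw`.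
theorem IsTangent.curvatureForm {p u v w : A} (hu : IsTangent p u) (hv : IsTangent p v)
    (hw : IsTangent p w) : IsTangent p (curvatureForm u v w) := by
  have key : ∀ {x y z : A}, IsTangent p x → IsTangent p y → IsTangent p z →
      reflectionOf p * (x * y * z) = -(x * y * z * reflectionOf p) := by
    intro x y z hx hy hz
    rw [← mul_assoc, hx.mul_commute hy, mul_assoc, hz.2, mul_neg, mul_assoc (x * y)]
  refine ⟨?_, ?_⟩
  · simp only [GrassmannCurvature.curvatureForm, star_sub, star_add, star_mul, hu.1, hv.1, hw.1]
    noncomm_ring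
  · simp only [GrassmannCurvature.curvatureForm, mul_sub, mul_add, sub_mul, add_mul,
      key hu hv hw, key hw hu hv, key hw hv hu, key hv hu hw]
    abel

end StarAlgebra

/-! ### Traces of two-sided multiplications on matrices. -/

section Trace

theorem trace_matrixEnd {n : Type*} [Fintype n] [DecidableEq n]
    (Φ : Matrix n n ℝ →ₗ[ℝ] Matrix n n ℝ) :
    LinearMap.trace ℝ _ Φ = ∑ i, ∑ j, Φ (Matrix.single i j 1) i j := by
  rw [LinearMap.trace_eq_matrix_trace ℝ (Matrix.stdBasis ℝ n n), Matrix.trace,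
    Fintype.sum_prod_type]
  refine Finset.sum_congr rfl fun i _ => Finset.sum_congr rfl fun j _ => ?_
  rw [Matrix.diag_apply, LinearMap.toMatrix_apply, Matrix.stdBasis_eq_single]
  simp [Matrix.stdBasis]

/-- On the matrix units, the diagonal coefficient at `(i, j)` is `a i i * b j j`. -/
theorem trace_matrix_mulLeftRight {n : Type*} [Fintype n] [DecidableEq n] (a b : Matrix n n ℝ)
    (Φ : Matrix n n ℝ →ₗ[ℝ] Matrix n n ℝ) (hΦ : ∀ x, Φ x = a * x * b) :
    LinearMap.trace ℝ _ Φ = a.trace * b.trace := by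
  rw [trace_matrixEnd, Matrix.trace, Matrix.trace, Finset.sum_mul_sum]
  refine Finset.sum_congr rfl fun i _ => Finset.sum_congr rfl fun j _ => ?_
  rw [hΦ, Matrix.mul_apply, Finset.sum_eq_single j]
  · simp
  · intro k _ hk
    rw [Matrix.mul_single_apply_of_ne _ _ _ _ _ hk, zero_mul]
  · simp

/-- The transpose swaps the indices of the matrix unit, so the diagonal coefficient is `a i j * b i
j`. -/
theorem trace_matrix_mulLeftRight_transpose {n : Type*} [Fintype n] [DecidableEq n]
    (a b : Matrix n n ℝ)
    (Φ : Matrix n n ℝ →ₗ[ℝ] Matrix n n ℝ) (hΦ : ∀ x, Φ x = a * x.transpose * b) :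
    LinearMap.trace ℝ _ Φ = (a * b.transpose).trace := by
  rw [trace_matrixEnd, Matrix.trace]
  refine Finset.sum_congr rfl fun i _ => ?_
  rw [Matrix.diag_apply, Matrix.mul_apply]
  refine Finset.sum_congr rfl fun j _ => ?_
  rw [hΦ, Matrix.mul_apply, Finset.sum_eq_single i]
  · simp
  · intro k _ hk
    rw [Matrix.transpose_single, Matrix.mul_single_apply_of_ne _ _ _ _ _ hk, zero_mul]
  · simp

end Trace

/-! ### Trace and Hilbert-Schmidt product on `L(E;E)`. -/

section FiniteDimension

variable {E : Type*} [NormedAddCommGroup E] [InnerProductSpace ℝ E] [FiniteDimensional ℝ E]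

/-- The trace of a continuous linear endomorphism, as a linear form. -/
def clmTrace : (E →L[ℝ] E) →ₗ[ℝ] ℝ :=
  LinearMap.trace ℝ E ∘ₗ ContinuousLinearMap.coeLM ℝ

omit [FiniteDimensional ℝ E] in
theorem clmTrace_mul_comm (x y : E →L[ℝ] E) : clmTrace (x * y) = clmTrace (y * x) :=
  LinearMap.trace_mul_comm ℝ (x : E →ₗ[ℝ] E) (y : E →ₗ[ℝ] E)

theorem clmTrace_one : clmTrace (1 : E →L[ℝ] E) = Module.finrank ℝ E :=
  LinearMap.trace_one ℝ E

/-- The matrix of a continuous linear endomorphism in the standard orthonormal basis. -/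
def matrixOf :
    (E →L[ℝ] E) ≃ₗ[ℝ] Matrix (Fin (Module.finrank ℝ E)) (Fin (Module.finrank ℝ E)) ℝ :=
  LinearMap.toContinuousLinearMap.symm.trans
    (LinearMap.toMatrix (stdOrthonormalBasis ℝ E).toBasis (stdOrthonormalBasis ℝ E).toBasis)

theorem matrixOf_mul (x y : E →L[ℝ] E) : matrixOf (x * y) = matrixOf x * matrixOf y :=
  LinearMap.toMatrix_mul (stdOrthonormalBasis ℝ E).toBasis (x : E →ₗ[ℝ] E) (y : E →ₗ[ℝ] E)

theorem trace_matrixOf (x : E →L[ℝ] E) : (matrixOf x).trace = clmTrace x :=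
  (LinearMap.trace_eq_matrix_trace ℝ (stdOrthonormalBasis ℝ E).toBasis (x : E →ₗ[ℝ] E)).symm

theorem matrixOf_star [CompleteSpace E] (x : E →L[ℝ] E) : matrixOf (star x) = (matrixOf x).transpose := by
  ext i j
  simp only [matrixOf, LinearEquiv.trans_apply, Matrix.transpose_apply, LinearMap.toMatrix_apply,
    OrthonormalBasis.coe_toBasis, OrthonormalBasis.coe_toBasis_repr_apply,
    OrthonormalBasis.repr_apply_apply]
  change inner ℝ _ ((ContinuousLinearMap.adjoint x) _) = inner ℝ _ (x _)
  rw [ContinuousLinearMap.adjoint_inner_right, real_inner_comm]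

theorem hsInner_eq_clmTrace [CompleteSpace E] (x y : E →L[ℝ] E) : hsInner x y = clmTrace (star x * y) := by
  rw [hsInner, clmTrace, LinearMap.comp_apply,
    LinearMap.trace_eq_sum_inner _ (stdOrthonormalBasis ℝ E)]
  refine Finset.sum_congr rfl fun k _ => ?_
  exact (ContinuousLinearMap.adjoint_inner_right x _ _).symm

theorem hsInner_self_nonneg (x : E →L[ℝ] E) : 0 ≤ hsInner x x :=
  Finset.sum_nonneg fun _ _ => real_inner_self_nonneg

theorem hsInner_self_eq_zero {x : E →L[ℝ] E} : hsInner x x = 0 ↔ x = 0 := by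
  refine ⟨fun h => ?_, fun h => by simp [h, hsInner]⟩
  rw [hsInner, Finset.sum_eq_zero_iff_of_nonneg fun _ _ => real_inner_self_nonneg] at h
  have h' : (x : E →ₗ[ℝ] E) = 0 := (stdOrthonormalBasis ℝ E).toBasis.ext fun k => by
    simpa using h k (Finset.mem_univ k)
  ext v
  exact LinearMap.congr_fun h' v

theorem trace_mulLeftRight (a b : E →L[ℝ] E) :
    LinearMap.trace ℝ _ (LinearMap.mulLeftRight ℝ (a, b)) = clmTrace a * clmTrace b := by
  rw [← LinearMap.trace_conj' _ matrixOf,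
    trace_matrix_mulLeftRight (matrixOf a) (matrixOf b), trace_matrixOf, trace_matrixOf]
  intro x
  simp [LinearEquiv.conj_apply, matrixOf_mul]

/-- The adjoint, as a linear map over `ℝ`. -/
def starLinear [CompleteSpace E] : (E →L[ℝ] E) →ₗ[ℝ] (E →L[ℝ] E) where
  toFun x := star x
  map_add' := star_add
  map_smul' r x := by simp

theorem trace_mulLeftRight_star [CompleteSpace E] (a b : E →L[ℝ] E) :
    LinearMap.trace ℝ _ (LinearMap.mulLeftRight ℝ (a, b) ∘ₗ starLinear) =
      clmTrace (a * star b) := by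
  rw [← LinearMap.trace_conj' _ matrixOf,
    trace_matrix_mulLeftRight_transpose (matrixOf a) (matrixOf b), ← matrixOf_star,
    ← matrixOf_mul, trace_matrixOf]
  intro x
  simp [LinearEquiv.conj_apply, matrixOf_mul, starLinear, matrixOf_star]

end FiniteDimension

/-! ### Tangent vectors from curves and from equations. -/

section Curves

variable {B : Type*} [NormedAddCommGroup B] [NormedSpace ℝ B]

theorem HasDerivAt.mem_tangentAt {M : Set B} {γ : ℝ → B} {v : B} (h : HasDerivAt γ v 0)
    (hγ : ∀ t, γ t ∈ M) : v ∈ tangentAt M (γ 0) := by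
  have h1 := h.hasFDerivAt.hasFDerivWithinAt (s := Set.univ) |>.mapsTo_tangent_cone
  have h2 := h1 (x := (1 : ℝ)) (by rw [tangentConeAt_univ]; trivial)
  refine Submodule.subset_span (tangentConeAt_mono ?_ (by simpa using h2))
  rintro _ ⟨t, -, rfl⟩
  exact hγ t

/-- The derivative within `M` is pinned down on velocities of curves in `M`, without any unique
differentiability of `M`. -/
theorem HasFDerivWithinAt.hasDerivAt_comp_curve {C : Type*} [NormedAddCommGroup C]
    [NormedSpace ℝ C] {M : Set B} {f : B → C} {f' : B →L[ℝ] C} {γ : ℝ → B} {v : B}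
    (hf : HasFDerivWithinAt f f' M (γ 0)) (h : HasDerivAt γ v 0) (hγ : ∀ t, γ t ∈ M) :
    HasDerivAt (fun t => f (γ t)) (f' v) 0 :=
  hasDerivWithinAt_univ.1 (hf.comp_hasDerivWithinAt 0 h.hasDerivWithinAt fun t _ => hγ t)

/-- The derivative maps the tangent cone of `M` into that of `f '' M ⊆ {0}`, which is trivial
because a single point has no accumulation point; the kernel is a subspace, so the span is killed
too. Equations defining `M` thus become linear constraints on tangent vectors. -/
theorem HasFDerivAt.eq_zero_of_mem_tangentAt {C : Type*} [NormedAddCommGroup C] [NormedSpace ℝ C]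
    {M : Set B} {f : B → C} {f' : B →L[ℝ] C} {x v : B} (h : HasFDerivAt f f' x)
    (hf : ∀ y ∈ M, f y = 0) (hx : x ∈ M) (hv : v ∈ tangentAt M x) : f' v = 0 := by
  have key : tangentAt M x ≤ LinearMap.ker (f' : B →ₗ[ℝ] C) := by
    refine Submodule.span_le.2 fun w hw => ?_
    have h1 := h.hasFDerivWithinAt (s := M) |>.mapsTo_tangent_cone hw
    have h2 : tangentConeAt ℝ (f '' M) (f x) ⊆ {0} := by
      refine tangentConeAt_subset_zero fun hacc => ?_
      have h3 : f '' M ⊆ {0} := by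
        rintro _ ⟨y, hy, rfl⟩
        exact hf y hy
      have := hacc.mono (Filter.principal_mono.2 h3)
      rw [hf x hx, accPt_iff_frequently] at this
      obtain ⟨y, hy0, hy⟩ := this.exists
      exact hy0 hy
    exact h2 h1
  exact key hv

end Curves

/-! ### Tangent spaces, the second fundamental form and curvature for star projections. -/

section StarAlgebra

variable {A : Type*} [NormedRing A] [NormedAlgebra ℝ A] [CompleteSpace A] [StarRing A]
  [ContinuousStar A] [StarModule ℝ A]

omit [CompleteSpace A] in
theorem mem_tangentAt_isStarProjection_aux {p u : A} (hp : IsStarProjection p)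
    (hu : u ∈ tangentAt {p : A | IsStarProjection p} p) : IsTangent p u := by
  constructor
  · have h := (((starL' ℝ : A ≃L[ℝ] A) : A →L[ℝ] A) - ContinuousLinearMap.id ℝ A).hasFDerivAt
      (x := p)
    refine sub_eq_zero.1 (HasFDerivAt.eq_zero_of_mem_tangentAt h (fun y hy => ?_) hp hu)
    exact sub_eq_zero.2 hy.isSelfAdjoint
  · have h := ((hasFDerivAt_id (𝕜 := ℝ) p).mul' (hasFDerivAt_id p)).sub (hasFDerivAt_id p)
    have h0 := HasFDerivAt.eq_zero_of_mem_tangentAt h (M := {p : A | IsStarProjection p})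
      (fun y hy => sub_eq_zero.2 hy.isIdempotentElem) hp hu
    rw [reflectionOf_mul_eq_neg_iff]
    simpa [sub_eq_zero] using h0

theorem mem_tangentAt_isStarProjection {p u : A} (hp : IsStarProjection p) :
    u ∈ tangentAt {p : A | IsStarProjection p} p ↔ IsTangent p u := by
  refine ⟨mem_tangentAt_isStarProjection_aux hp, fun hu => ?_⟩
  have h := hasDerivAt_conjExp (generator p u) p
  rw [generator_bracket_self hp hu] at h
  simpa only [conjExp_zero] using HasDerivAt.mem_tangentAt (M := {p : A | IsStarProjection p}) h
    fun t => conjExp_isStarProjection (star_generator hp hu) hp t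

theorem canonicalForm_mem_tangentAt_tangentBundleSet {p w u : A} (hp : IsStarProjection p)
    (hw : IsTangent p w) (hu : IsTangent p u) :
    (u, canonicalForm p w u) ∈
      tangentAt (tangentBundleSet {p : A | IsStarProjection p}) (p, w) := by
  have ha := star_generator hp hu
  have h := (hasDerivAt_conjExp (generator p u) p).prodMk (hasDerivAt_conjExp (generator p u) w)
  rw [generator_bracket_self hp hu, generator_bracket hu, canonicalForm_comm hw hu] at h
  simpa only [conjExp_zero] using HasDerivAt.mem_tangentAt
    (M := tangentBundleSet {p : A | IsStarProjection p}) h fun t =>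
    ⟨conjExp_isStarProjection ha hp t,
      (mem_tangentAt_isStarProjection (conjExp_isStarProjection ha hp t)).2
        (conjExp_isTangent ha hw t)⟩

omit [CompleteSpace A] in
-- The equation `pw + wp = w` holds on the tangent bundle; its derivative along `(u, z)` is `pz + uw
-- + wu + zp = z`. When `z` commutes with `p` this reads `(1 - 2p)z = wu + uw`, and the reflection
-- is its own inverse.
theorem eq_canonicalForm_of_mem_tangentAt {p w u z : A} (hp : IsStarProjection p)
    (hw : IsTangent p w) (hu : IsTangent p u) (hz : z * p = p * z)
    (h : (u, z) ∈ tangentAt (tangentBundleSet {p : A | IsStarProjection p}) (p, w))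
    (hpw : (p, w) ∈ tangentBundleSet {p : A | IsStarProjection p}) :
    z = canonicalForm p w u := by
  have hf := (((hasFDerivAt_fst (𝕜 := ℝ) (p := (p, w))).mul' hasFDerivAt_snd).add
    (hasFDerivAt_snd.mul' hasFDerivAt_fst)).sub hasFDerivAt_snd
  have h0 := HasFDerivAt.eq_zero_of_mem_tangentAt hf
    (M := tangentBundleSet {p : A | IsStarProjection p})
    (fun y hy => sub_eq_zero.2 (reflectionOf_mul_eq_neg_iff.1
      (mem_tangentAt_isStarProjection_aux hy.1 hy.2).2)) hpw h
  have h1 : p * z + u * w + (w * u + z * p) - z = 0 := by simpa using h0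
  have h2 : reflectionOf p * z = w * u + u * w := by
    rw [reflectionOf, sub_mul, one_mul, smul_mul_assoc, two_smul]
    nth_rw 2 [← hz]
    rw [← sub_eq_zero, ← neg_eq_zero, ← h1]
    abel
  rw [canonicalForm_eq hu hw, ← h2, ← mul_assoc, reflectionOf_mul_self hp.isIdempotentElem,
    one_mul]

/-- Transporting vectors along the curve through `p` with velocity `u` computes the derivative
of a smooth extension of the canonical form. -/
theorem fderivWithin_extension_apply {Θ : A → A →L[ℝ] A →L[ℝ] A} {p u v w : A}
    (hΘ : DifferentiableWithinAt ℝ Θ {p : A | IsStarProjection p} p)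
    (hext : ∀ q x y : A, IsStarProjection q → IsTangent q x → IsTangent q y →
      Θ q x y = canonicalForm q x y)
    (hp : IsStarProjection p) (hu : IsTangent p u) (hv : IsTangent p v) (hw : IsTangent p w) :
    fderivWithin ℝ Θ {p : A | IsStarProjection p} p u w v
      + Θ p (canonicalForm p w u) v + Θ p w (canonicalForm p v u) =
    generator p u * canonicalForm p w v - canonicalForm p w v * generator p u := by
  set a := generator p u with ha_def
  have ha : star a = -a := star_generator hp hu
  have hγ : HasDerivAt (fun t => conjExp a t p) u 0 := by
    have := hasDerivAt_conjExp a p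
    rwa [ha_def, generator_bracket_self hp hu] at this
  have hd : ∀ {x : A}, IsTangent p x →
      HasDerivAt (fun t => conjExp a t x) (canonicalForm p x u) 0 := by
    intro x hx
    have := hasDerivAt_conjExp a x
    rwa [ha_def, generator_bracket hu, canonicalForm_comm hx hu] at this
  have hΘ' : HasFDerivWithinAt Θ (fderivWithin ℝ Θ {p : A | IsStarProjection p} p)
      {p : A | IsStarProjection p} (conjExp a 0 p) := by
    simpa only [conjExp_zero] using hΘ.hasFDerivWithinAt
  have h1 : HasDerivAt (fun t => Θ (conjExp a t p))
      (fderivWithin ℝ Θ {p : A | IsStarProjection p} p u) 0 :=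
    HasFDerivWithinAt.hasDerivAt_comp_curve (f := Θ) (γ := fun t => conjExp a t p) hΘ' hγ
      fun t => conjExp_isStarProjection ha hp t
  have h2 := (h1.clm_apply (hd hw)).clm_apply (hd hv)
  -- The transported vectors stay tangent to `G`, so along the curve the arbitrary extension may be
  -- replaced by the canonical form, which is equivariant.
  have h3 : (fun t => Θ (conjExp a t p) (conjExp a t w) (conjExp a t v)) =
      fun t => conjExp a t (canonicalForm p w v) := by
    funext t
    rw [conjExp_canonicalForm, hext _ _ _ (conjExp_isStarProjection ha hp t)
      (conjExp_isTangent ha hw t) (conjExp_isTangent ha hv t)]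
  rw [h3] at h2
  simpa only [conjExp_zero, add_apply] using
    h2.unique (hasDerivAt_conjExp a (canonicalForm p w v))

/-- The values of `Θ` on the non-tangent vectors `canonicalForm p w u` depend on the extension, but
only through the combination computed by `fderivWithin_extension_apply`. Subtracting its versions
for `(u, v)` and `(v, u)` cancels `Θ p w (canonicalForm p v u)` by symmetry. -/
theorem curvatureExpr_eq_curvatureForm {Θ : A → A →L[ℝ] A →L[ℝ] A} {p u v w : A}
    (hΘ : DifferentiableWithinAt ℝ Θ {p : A | IsStarProjection p} p)
    (hext : ∀ q x y : A, IsStarProjection q → IsTangent q x → IsTangent q y →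
      Θ q x y = canonicalForm q x y)
    (hp : IsStarProjection p) (hu : IsTangent p u) (hv : IsTangent p v) (hw : IsTangent p w) :
    curvatureExpr {p : A | IsStarProjection p} Θ p u v w = curvatureForm u v w := by
  have h1 := fderivWithin_extension_apply hΘ hext hp hu hv hw
  have h2 := fderivWithin_extension_apply hΘ hext hp hv hu hw
  rw [generator_bracket_canonicalForm hp hu hv hw, canonicalForm_comm hu hv] at h1
  rw [generator_bracket_canonicalForm hp hv hu hw] at h2
  rw [curvatureExpr, hext p w u hp hw hu, hext p w v hp hw hv, curvatureForm,
    ← sub_eq_zero, ← sub_eq_zero.2 (congrArg₂ (· - ·) h1 h2)]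
  noncomm_ring

/-- The canonical form as a bilinear map depending smoothly on the base point. -/
def canonicalExtension (p : A) : A →L[ℝ] A →L[ℝ] A :=
  (ContinuousLinearMap.mul ℝ A).comp (ContinuousLinearMap.mul ℝ A (reflectionOf p)) +
    (ContinuousLinearMap.mul ℝ A).flip.comp ((ContinuousLinearMap.mul ℝ A).flip (reflectionOf p))

omit [CompleteSpace A] [StarRing A] [ContinuousStar A] [StarModule ℝ A] in
theorem canonicalExtension_apply (p w u : A) : canonicalExtension p w u = canonicalForm p w u := by
  simp [canonicalExtension, canonicalForm, mul_assoc]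

omit [CompleteSpace A] [StarRing A] [ContinuousStar A] [StarModule ℝ A] in
theorem contDiffOn_canonicalExtension (M : Set A) : ContDiffOn ℝ ∞ canonicalExtension M := by
  have h : ContDiff ℝ ∞ (reflectionOf : A → A) := by unfold reflectionOf; fun_prop
  have h1 : ContDiff ℝ ∞ fun p : A => ContinuousLinearMap.mul ℝ A (reflectionOf p) :=
    (ContinuousLinearMap.mul ℝ A).contDiff.comp h
  have h2 : ContDiff ℝ ∞ fun p : A => (ContinuousLinearMap.mul ℝ A).flip (reflectionOf p) :=
    (ContinuousLinearMap.mul ℝ A).flip.contDiff.comp h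
  exact ((ContDiff.clm_comp (g := fun _ => ContinuousLinearMap.mul ℝ A) contDiff_const h1).add
    (ContDiff.clm_comp (g := fun _ => (ContinuousLinearMap.mul ℝ A).flip) contDiff_const h2)).contDiffOn

end StarAlgebra

/-! ### Trace computations for the sectional and Ricci terms. -/

section Ricci

variable {E : Type*} [NormedAddCommGroup E] [InnerProductSpace ℝ E] [FiniteDimensional ℝ E]
  [CompleteSpace E]

omit [FiniteDimensional ℝ E] in
-- With `s² = 1`, `tr u = tr(s(su)) = tr(sus) = -tr u`.
theorem clmTrace_mul_reflectionOf_eq_zero {p u : E →L[ℝ] E} (hp : IsStarProjection p)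
    (hu : reflectionOf p * u = -(u * reflectionOf p)) : clmTrace u = 0 := by
  have h : clmTrace u = -clmTrace u := by
    conv_lhs => rw [← one_mul u, ← reflectionOf_mul_self hp.isIdempotentElem, mul_assoc,
      clmTrace_mul_comm, hu]
    rw [neg_mul, mul_assoc, reflectionOf_mul_self hp.isIdempotentElem, mul_one, map_neg]
  linarith

omit [FiniteDimensional ℝ E] [CompleteSpace E] in
theorem clmTrace_curvatureForm_mul (α β : E →L[ℝ] E) :
    clmTrace (curvatureForm α β α * β) =
      2 * clmTrace (β * α * (α * β)) - 2 * clmTrace (β * α * (β * α)) := by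
  have h1 : clmTrace (α * α * β * β) = clmTrace (β * α * (α * β)) := by
    rw [clmTrace_mul_comm]; simp only [mul_assoc]
  have h2 : clmTrace (α * β * α * β) = clmTrace (β * α * (β * α)) := by
    rw [clmTrace_mul_comm]; simp only [mul_assoc]
  have h3 : clmTrace (β * α * α * β) = clmTrace (β * α * (α * β)) := by simp only [mul_assoc]
  simp only [curvatureForm, sub_mul, add_mul, map_sub, map_add, h1, h2, h3]
  ring

/-- The orthogonal projection of `L(E;E)` onto the tangent space at the projection `p`, up to the
factor `4`. -/
def fourTangentProj (p : E →L[ℝ] E) : (E →L[ℝ] E) →ₗ[ℝ] (E →L[ℝ] E) :=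
  LinearMap.id + starLinear - LinearMap.mulLeftRight ℝ (reflectionOf p, reflectionOf p)
    - LinearMap.mulLeftRight ℝ (reflectionOf p, reflectionOf p) ∘ₗ starLinear

omit [FiniteDimensional ℝ E] in
theorem fourTangentProj_apply (p x : E →L[ℝ] E) : fourTangentProj p x =
    x + star x - reflectionOf p * x * reflectionOf p
      - reflectionOf p * star x * reflectionOf p := by
  simp [fourTangentProj, starLinear]

omit [FiniteDimensional ℝ E] in
theorem isTangent_fourTangentProj {p : E →L[ℝ] E} (hp : IsStarProjection p) (x : E →L[ℝ] E) :
    IsTangent p (fourTangentProj p x) := by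
  have hs := reflectionOf_mul_self hp.isIdempotentElem
  have h1 : ∀ y, reflectionOf p * (reflectionOf p * y) = y := fun y => by
    rw [← mul_assoc, hs, one_mul]
  rw [fourTangentProj_apply]
  refine ⟨?_, ?_⟩
  · simp only [star_sub, star_add, star_mul, star_star, star_reflectionOf hp, mul_assoc]
    abel
  · simp only [mul_sub, sub_mul, mul_add, add_mul, mul_assoc, h1, hs, mul_one]
    abel

omit [FiniteDimensional ℝ E] in
theorem fourTangentProj_of_isTangent {p x : E →L[ℝ] E} (hp : IsStarProjection p)
    (hx : IsTangent p x) : fourTangentProj p x = (4 : ℝ) • x := by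
  rw [fourTangentProj_apply, hx.1, hx.2, neg_mul, mul_assoc,
    reflectionOf_mul_self hp.isIdempotentElem, mul_one]
  module

/-- All traces of single tangent vectors vanish, also after multiplication by `s`. The surviving `x
↦ axb` terms with a factor `1` give `2N tr(αβ)`; those with `tr s` cancel, so the rank of `p` plays
no role. The starred terms without `s` cancel, and those with `s` give `-4 tr(αβ)`. -/
theorem trace_curvatureForm_comp_fourTangentProj {p α β : E →L[ℝ] E} (hp : IsStarProjection p)
    (hα : IsTangent p α) (hβ : IsTangent p β) (Φ : (E →L[ℝ] E) →ₗ[ℝ] (E →L[ℝ] E))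
    (hΦ : ∀ x, Φ x = curvatureForm α (fourTangentProj p x) β) :
    LinearMap.trace ℝ _ Φ = (2 * Module.finrank ℝ E - 4) * clmTrace (α * β) := by
  set s := reflectionOf p with hs_def
  have hs : s * s = 1 := reflectionOf_mul_self hp.isIdempotentElem
  have hss : star s = s := star_reflectionOf hp
  have key : Φ =
      LinearMap.mulLeftRight ℝ (β * α, 1) - LinearMap.mulLeftRight ℝ (β, α)
      + LinearMap.mulLeftRight ℝ (1, α * β) - LinearMap.mulLeftRight ℝ (α, β)
      + (LinearMap.mulLeftRight ℝ (β * α, 1) - LinearMap.mulLeftRight ℝ (β, α)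
      + LinearMap.mulLeftRight ℝ (1, α * β) - LinearMap.mulLeftRight ℝ (α, β)) ∘ₗ starLinear
      - (LinearMap.mulLeftRight ℝ (β * α * s, s) - LinearMap.mulLeftRight ℝ (β * s, s * α)
      + LinearMap.mulLeftRight ℝ (s, s * (α * β)) - LinearMap.mulLeftRight ℝ (α * s, s * β))
      - (LinearMap.mulLeftRight ℝ (β * α * s, s) - LinearMap.mulLeftRight ℝ (β * s, s * α)
      + LinearMap.mulLeftRight ℝ (s, s * (α * β))
      - LinearMap.mulLeftRight ℝ (α * s, s * β)) ∘ₗ starLinear := by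
    refine LinearMap.ext fun x => ?_
    rw [hΦ, fourTangentProj_apply]
    simp only [curvatureForm, LinearMap.add_apply, LinearMap.sub_apply, LinearMap.comp_apply,
      LinearMap.mulLeftRight_apply, starLinear, LinearMap.coe_mk, AddHom.coe_mk, ← hs_def]
    noncomm_ring
  have tα : clmTrace α = 0 := clmTrace_mul_reflectionOf_eq_zero hp hα.2
  have ts : ∀ {u : E →L[ℝ] E}, IsTangent p u → clmTrace (s * u) = 0 := fun {u} hu =>
    clmTrace_mul_reflectionOf_eq_zero hp (by
      rw [← hs_def, mul_assoc s u s, ← mul_neg, hs_def, hu.2])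
  have tβα : clmTrace (β * α) = clmTrace (α * β) := clmTrace_mul_comm β α
  -- This sign makes the two terms containing `tr s` cancel.
  have tβαs : clmTrace (β * α * s) = -clmTrace (s * (α * β)) := by
    rw [← mul_assoc, hs_def, hα.2, ← hs_def, neg_mul, map_neg, neg_neg, mul_assoc α, mul_assoc β,
      clmTrace_mul_comm β, mul_assoc α]
  have t4 : ∀ {u v : E →L[ℝ] E}, IsTangent p v →
      clmTrace (u * s * (v * s)) = -clmTrace (u * v) := by
    intro u v hv
    have h : s * (v * s) = -v := by
      rw [← mul_assoc, hs_def, hv.2, ← hs_def, neg_mul, mul_assoc, hs, mul_one]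
    rw [mul_assoc, h, mul_neg, map_neg]
  have t5 : clmTrace (β * α * s * s) = clmTrace (β * α) := by rw [mul_assoc (β * α), hs, mul_one]
  have t6 : clmTrace (s * (β * α * s)) = clmTrace (β * α) := by rw [clmTrace_mul_comm, t5]
  rw [key]
  simp only [LinearMap.sub_comp, LinearMap.add_comp, map_add, map_sub, trace_mulLeftRight,
    trace_mulLeftRight_star, star_mul, star_one, hα.1, hβ.1, hss, tα, ts hα, ts hβ, t4 hα, t4 hβ,
    t5, t6, clmTrace_one, mul_one, one_mul, tβαs, tβα]
  ring

end Ricci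

/-! ### Canonical connection and curvature of the Grassmann manifold. -/

section Grassmannian

variable {E : Type*} [NormedAddCommGroup E] [InnerProductSpace ℝ E] [CompleteSpace E]

theorem grassmann_eq : grassmann E = {p : E →L[ℝ] E | IsStarProjection p} := by
  ext p
  refine ⟨?_, fun hp => ?_⟩
  · rintro ⟨F, -, _, rfl⟩
    exact isStarProjection_starProjection
  · obtain ⟨F, hF, h⟩ := isStarProjection_iff_eq_starProjection.1 hp
    -- A subspace with an orthogonal projection equals its double orthogonal complement, hence is
    -- closed.
    exact ⟨F, by
      rw [← F.orthogonal_orthogonal]; exact F.orthogonal.isClosed_orthogonal, hF, h⟩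

theorem isStarProjection_coe (ξ : grassmann E) : IsStarProjection (ξ : E →L[ℝ] E) :=
  grassmann_eq.subset ξ.2

theorem mem_tangentAt_grassmann {ξ u : E →L[ℝ] E} (hξ : IsStarProjection ξ) :
    u ∈ tangentAt (grassmann E) ξ ↔ IsTangent ξ u := by
  rw [grassmann_eq, mem_tangentAt_isStarProjection hξ]

theorem isTangent_coe {ξ : grassmann E} (u : tangentAt (grassmann E) (ξ : E →L[ℝ] E)) :
    IsTangent (ξ : E →L[ℝ] E) u :=
  (mem_tangentAt_grassmann (isStarProjection_coe ξ)).1 u.2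

/-- The canonical connection of the Grassmann manifold. -/
def canonicalConnection : BilinearFamily (grassmann E) := fun ξ =>
  LinearMap.mk₂ ℝ (fun w u => canonicalForm (ξ : E →L[ℝ] E) w u)
    (fun _ _ _ => by simp only [canonicalForm, Submodule.coe_add]; noncomm_ring)
    (fun _ _ _ => by simp [canonicalForm])
    (fun _ _ _ => by simp only [canonicalForm, Submodule.coe_add]; noncomm_ring)
    (fun _ _ _ => by simp [canonicalForm])

theorem isCanonicalConnection_canonicalConnection :
    IsCanonicalConnection (canonicalConnection (E := E)) := by
  refine ⟨fun ξ w u => ?_, fun ξ w u => ⟨?_, ?_⟩⟩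
  · have h := canonicalForm_mem_tangentAt_tangentBundleSet (isStarProjection_coe ξ)
      (isTangent_coe w) (isTangent_coe u)
    rwa [← grassmann_eq] at h
  · exact star_canonicalForm (isStarProjection_coe ξ) (isTangent_coe u) (isTangent_coe w)
  · exact reflectionOf_commute_iff.1
      (reflectionOf_mul_canonicalForm (isTangent_coe u) (isTangent_coe w))

theorem IsCanonicalConnection.apply_eq {θ : BilinearFamily (grassmann E)}
    (hθ : IsCanonicalConnection θ) (ξ : grassmann E)
    (w u : tangentAt (grassmann E) (ξ : E →L[ℝ] E)) :
    θ ξ w u = canonicalForm (ξ : E →L[ℝ] E) w u := by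
  have key : ∀ {p w u z : E →L[ℝ] E}, IsStarProjection p → IsTangent p w → IsTangent p u →
      z * p = p * z → (u, z) ∈ tangentAt (tangentBundleSet (grassmann E)) (p, w) →
      (p, w) ∈ tangentBundleSet (grassmann E) → z = canonicalForm p w u := by
    rw [grassmann_eq]
    exact eq_canonicalForm_of_mem_tangentAt
  exact key (isStarProjection_coe ξ) (isTangent_coe w) (isTangent_coe u) (hθ.2 ξ w u).2
    (hθ.1 ξ w u) ⟨ξ.2, w.2⟩

theorem existsUnique_isCanonicalConnection :
    ∃! θ : BilinearFamily (grassmann E), IsCanonicalConnection θ := by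
  refine ⟨canonicalConnection, isCanonicalConnection_canonicalConnection, fun θ hθ => ?_⟩
  funext ξ
  refine LinearMap.ext₂ fun w u => ?_
  rw [hθ.apply_eq]
  rfl

/-- The curvature tensor of the canonical connection. -/
def canonicalCurvature : TrilinearFamily (grassmann E) := fun ξ =>
  LinearMap.mk₂ ℝ
    (fun u v =>
      { toFun := fun w => ⟨curvatureForm (u : E →L[ℝ] E) v w,
          (mem_tangentAt_grassmann (isStarProjection_coe ξ)).2
            ((isTangent_coe u).curvatureForm (isTangent_coe v) (isTangent_coe w))⟩
        map_add' := fun _ _ => Subtype.ext (by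
          simp only [curvatureForm, Submodule.coe_add]; noncomm_ring)
        map_smul' := fun _ _ => Subtype.ext (by
          simp [curvatureForm, smul_sub, smul_add]) })
    (fun _ _ _ => LinearMap.ext fun _ => Subtype.ext (by
      simp only [curvatureForm, Submodule.coe_add, LinearMap.add_apply, LinearMap.coe_mk,
        AddHom.coe_mk]
      noncomm_ring))
    (fun _ _ _ => LinearMap.ext fun _ => Subtype.ext (by
      simp [curvatureForm, smul_sub, smul_add]))
    (fun _ _ _ => LinearMap.ext fun _ => Subtype.ext (by
      simp only [curvatureForm, Submodule.coe_add, LinearMap.add_apply, LinearMap.coe_mk,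
        AddHom.coe_mk]
      noncomm_ring))
    (fun _ _ _ => LinearMap.ext fun _ => Subtype.ext (by
      simp [curvatureForm, smul_sub, smul_add]))

theorem IsCanonicalConnection.isSmoothExtension_canonicalExtension
    {θ : BilinearFamily (grassmann E)} (hθ : IsCanonicalConnection θ) :
    IsSmoothExtension θ canonicalExtension :=
  ⟨contDiffOn_canonicalExtension _, fun ξ w u => by
    rw [canonicalExtension_apply, hθ.apply_eq]⟩

theorem IsCanonicalConnection.curvatureExpr_eq {θ : BilinearFamily (grassmann E)}
    (hθ : IsCanonicalConnection θ)
    {Θ : (E →L[ℝ] E) → (E →L[ℝ] E) →L[ℝ] (E →L[ℝ] E) →L[ℝ] (E →L[ℝ] E)}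
    (hΘ : IsSmoothExtension θ Θ) (ξ : grassmann E)
    (u v w : tangentAt (grassmann E) (ξ : E →L[ℝ] E)) :
    curvatureExpr (grassmann E) Θ ξ u v w = curvatureForm (u : E →L[ℝ] E) v w := by
  have hd : DifferentiableWithinAt ℝ Θ (grassmann E) ξ :=
    hΘ.1.differentiableOn (by simp) ξ ξ.2
  have key : ∀ {p u v w : E →L[ℝ] E}, DifferentiableWithinAt ℝ Θ (grassmann E) p →
      (∀ q x y : E →L[ℝ] E, IsStarProjection q → IsTangent q x → IsTangent q y →
        Θ q x y = canonicalForm q x y) →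
      IsStarProjection p → IsTangent p u → IsTangent p v → IsTangent p w →
      curvatureExpr (grassmann E) Θ p u v w = curvatureForm u v w := by
    rw [grassmann_eq]
    exact curvatureExpr_eq_curvatureForm
  refine key hd (fun q x y hq hx hy => ?_) (isStarProjection_coe ξ)
    (isTangent_coe u) (isTangent_coe v) (isTangent_coe w)
  have hq' : q ∈ grassmann E := by rwa [grassmann_eq]
  have h := hΘ.2 ⟨q, hq'⟩ ⟨x, (mem_tangentAt_grassmann hq).2 hx⟩
    ⟨y, (mem_tangentAt_grassmann hq).2 hy⟩
  rwa [hθ.apply_eq] at h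

theorem IsCurvatureTensor.apply_eq {θ : BilinearFamily (grassmann E)}
    {R : TrilinearFamily (grassmann E)} (hR : IsCurvatureTensor θ R)
    (hθ : IsCanonicalConnection θ) (ξ : grassmann E)
    (u v w : tangentAt (grassmann E) (ξ : E →L[ℝ] E)) :
    (R ξ u v w : E →L[ℝ] E) = curvatureForm (u : E →L[ℝ] E) v w := by
  rw [hR.2 _ hθ.isSmoothExtension_canonicalExtension,
    hθ.curvatureExpr_eq hθ.isSmoothExtension_canonicalExtension]

theorem IsCanonicalConnection.existsUnique_isCurvatureTensor {θ : BilinearFamily (grassmann E)}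
    (hθ : IsCanonicalConnection θ) :
    ∃! R : TrilinearFamily (grassmann E), IsCurvatureTensor θ R := by
  refine ⟨canonicalCurvature, ⟨⟨_, hθ.isSmoothExtension_canonicalExtension⟩,
    fun Θ hΘ ξ u v w => ?_⟩, fun R hR => ?_⟩
  · rw [hθ.curvatureExpr_eq hΘ]
    rfl
  · funext ξ
    refine LinearMap.ext fun u => LinearMap.ext fun v => LinearMap.ext fun w => Subtype.ext ?_
    rw [hR.apply_eq hθ]
    rfl

end Grassmannian

/-! ### Sectional and Ricci curvature in finite dimension. -/

section FiniteDimension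

variable {E : Type*} [NormedAddCommGroup E] [InnerProductSpace ℝ E] [CompleteSpace E]
  [FiniteDimensional ℝ E] {θ : BilinearFamily (grassmann E)} {R : TrilinearFamily (grassmann E)}

theorem IsCurvatureTensor.riem_eq (hR : IsCurvatureTensor θ R)
    (hθ : IsCanonicalConnection θ) (ξ : grassmann E)
    (α β : tangentAt (grassmann E) (ξ : E →L[ℝ] E)) :
    riem R ξ α β = 2 * hsInner ((α : E →L[ℝ] E) * (β : E →L[ℝ] E)) ((α : E →L[ℝ] E) * (β : E →L[ℝ] E))
      - 2 * hsInner ((α : E →L[ℝ] E) * (β : E →L[ℝ] E)) ((β : E →L[ℝ] E) * (α : E →L[ℝ] E)) := by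
  rw [riem, hsInner_eq_clmTrace, hsInner_eq_clmTrace, hsInner_eq_clmTrace, (isTangent_coe _).1,
    hR.apply_eq hθ, clmTrace_curvatureForm_mul, star_mul, (isTangent_coe α).1,
    (isTangent_coe β).1]

/-- Cyclicity gives `|αβ| = |βα|`, so the formula for `Riem` is an expanded square; nonnegativity
and the equality case follow. -/
theorem IsCurvatureTensor.riem_eq_hsInner_commutator (hR : IsCurvatureTensor θ R)
    (hθ : IsCanonicalConnection θ) (ξ : grassmann E)
    (α β : tangentAt (grassmann E) (ξ : E →L[ℝ] E)) :
    riem R ξ α β = hsInner ((α : E →L[ℝ] E) * (β : E →L[ℝ] E) - (β : E →L[ℝ] E) * (α : E →L[ℝ] E))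
      ((α : E →L[ℝ] E) * (β : E →L[ℝ] E) - (β : E →L[ℝ] E) * (α : E →L[ℝ] E)) := by
  rw [hR.riem_eq hθ]
  obtain ⟨a, ha⟩ := α
  obtain ⟨b, hb⟩ := β
  have ha' := (isTangent_coe ⟨a, ha⟩).1
  have hb' := (isTangent_coe ⟨b, hb⟩).1
  dsimp only at ha' hb' ⊢
  have h1 : clmTrace (a * b * (b * a)) = clmTrace (b * a * (a * b)) := clmTrace_mul_comm _ _
  have h2 : clmTrace (a * b * (a * b)) = clmTrace (b * a * (b * a)) := by
    rw [mul_assoc, clmTrace_mul_comm]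
    simp only [mul_assoc]
  simp only [hsInner_eq_clmTrace, star_sub, star_mul, ha', hb', sub_mul, mul_sub, map_sub, h1, h2]
  ring

theorem IsCurvatureTensor.ricci_eq (hR : IsCurvatureTensor θ R)
    (hθ : IsCanonicalConnection θ) (ξ : grassmann E)
    (α β : tangentAt (grassmann E) (ξ : E →L[ℝ] E)) :
    ricci R ξ α β = ((Module.finrank ℝ E : ℝ) - 2) / 2 * hsInner (α : E →L[ℝ] E) β := by
  have hξ := isStarProjection_coe ξ
  let T := tangentAt (grassmann E) (ξ : E →L[ℝ] E)
  let P : (E →L[ℝ] E) →ₗ[ℝ] T := (fourTangentProj (ξ : E →L[ℝ] E)).codRestrict T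
    fun x => (mem_tangentAt_grassmann hξ).2 (isTangent_fourTangentProj hξ x)
  have hP : P ∘ₗ T.subtype = (4 : ℝ) • LinearMap.id := LinearMap.ext fun x =>
    Subtype.ext (fourTangentProj_of_isTangent hξ (isTangent_coe x))
  -- `P` is four times the identity on `T`; moving the inclusion around by cyclicity then turns this
  -- trace on `T` into one on `L(E;E)`.
  have h1 : LinearMap.trace ℝ T ((R ξ α).flip β ∘ₗ P ∘ₗ T.subtype) = 4 * ricci R ξ α β := by
    rw [hP, LinearMap.comp_smul, LinearMap.comp_id, map_smul, smul_eq_mul]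
    rfl
  have h2 := trace_curvatureForm_comp_fourTangentProj hξ (isTangent_coe α) (isTangent_coe β)
    (T.subtype ∘ₗ (R ξ α).flip β ∘ₗ P) fun x => hR.apply_eq hθ ξ α (P x) β
  rw [← LinearMap.comp_assoc, LinearMap.trace_comp_comm', h2] at h1
  rw [hsInner_eq_clmTrace, (isTangent_coe α).1]
  linarith

end FiniteDimension

end GrassmannCurvature

end

theorem mainTheorem5 (E : Type*) [NormedAddCommGroup E] [InnerProductSpace ℝ E]
    [CompleteSpace E] :
    (∃! θ : GrassmannCurvature.BilinearFamily (GrassmannCurvature.grassmann E),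
      GrassmannCurvature.IsCanonicalConnection θ) ∧
    ∀ θ : GrassmannCurvature.BilinearFamily (GrassmannCurvature.grassmann E),
      GrassmannCurvature.IsCanonicalConnection θ →
      (∀ (ξ : GrassmannCurvature.grassmann E)
        (η α : GrassmannCurvature.tangentAt (GrassmannCurvature.grassmann E) (ξ : E →L[ℝ] E)),
        θ ξ η α = (1 - (2 : ℝ) • (ξ : E →L[ℝ] E)) * (η : E →L[ℝ] E) * (α : E →L[ℝ] E)
          + (α : E →L[ℝ] E) * (η : E →L[ℝ] E) * (1 - (2 : ℝ) • (ξ : E →L[ℝ] E))) ∧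
      (∃! R : GrassmannCurvature.TrilinearFamily (GrassmannCurvature.grassmann E),
        GrassmannCurvature.IsCurvatureTensor θ R) ∧
      ∀ R : GrassmannCurvature.TrilinearFamily (GrassmannCurvature.grassmann E),
        GrassmannCurvature.IsCurvatureTensor θ R →
        (∀ (ξ : GrassmannCurvature.grassmann E)
          (α β η : GrassmannCurvature.tangentAt (GrassmannCurvature.grassmann E)
            (ξ : E →L[ℝ] E)),
          (R ξ α β η : E →L[ℝ] E) =
            (η : E →L[ℝ] E) * (α : E →L[ℝ] E) * (β : E →L[ℝ] E)
            - (η : E →L[ℝ] E) * (β : E →L[ℝ] E) * (α : E →L[ℝ] E)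
            + (β : E →L[ℝ] E) * (α : E →L[ℝ] E) * (η : E →L[ℝ] E)
            - (α : E →L[ℝ] E) * (β : E →L[ℝ] E) * (η : E →L[ℝ] E)) ∧
        ∀ [FiniteDimensional ℝ E] (ξ : GrassmannCurvature.grassmann E)
          (α β : GrassmannCurvature.tangentAt (GrassmannCurvature.grassmann E)
            (ξ : E →L[ℝ] E)),
          GrassmannCurvature.riem R ξ α β =
            2 * GrassmannCurvature.hsInner ((α : E →L[ℝ] E) * (β : E →L[ℝ] E))
                ((α : E →L[ℝ] E) * (β : E →L[ℝ] E))
            - 2 * GrassmannCurvature.hsInner ((α : E →L[ℝ] E) * (β : E →L[ℝ] E))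
                ((β : E →L[ℝ] E) * (α : E →L[ℝ] E)) ∧
          0 ≤ GrassmannCurvature.riem R ξ α β ∧
          (GrassmannCurvature.riem R ξ α β = 0 ↔
            (α : E →L[ℝ] E) * (β : E →L[ℝ] E) = (β : E →L[ℝ] E) * (α : E →L[ℝ] E)) ∧
          GrassmannCurvature.ricci R ξ α β =
            ((Module.finrank ℝ E : ℝ) - 2) / 2 *
              GrassmannCurvature.hsInner (α : E →L[ℝ] E) (β : E →L[ℝ] E) := by
  refine ⟨GrassmannCurvature.existsUnique_isCanonicalConnection, fun θ hθ =>
    ⟨hθ.apply_eq, hθ.existsUnique_isCurvatureTensor, fun R hR => ⟨hR.apply_eq hθ, ?_⟩⟩⟩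
  intro _ ξ α β
  have h := hR.riem_eq_hsInner_commutator hθ ξ α β
  refine ⟨hR.riem_eq hθ ξ α β, ?_, ?_, hR.ricci_eq hθ ξ α β⟩
  · rw [h]
    exact GrassmannCurvature.hsInner_self_nonneg _
  · rw [h, GrassmannCurvature.hsInner_self_eq_zero, sub_eq_zero]
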